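/- For an integer $r\ge 0$, a graph $M$ is an $r$-shallow topological minor of a graph $G$ if the vertices of $M$ can be mapped injectively to vertices of $G$ (the nails) and every edge of $M$ can be modelled by a path of length at most $2r+1$ in $G$ between the corresponding nails, such that no nail is an inner vertex of one of these paths and paths modelling different edges share no inner vertices. The topological grad of $G$ at depth $r$ is the maximum of $|E(H)|/|V(H)|$ over all non-empty $r$-shallow topological minors $H$ of $G$; the topological grad of a class of finite graphs (closed under isomorphism) is the supremum over its members. The class has bounded expansion if there is a real-valued function $f$ such that its topological grad at depth $r$ is less than $f(r)$ for every $r\ge 0$. For $n\ge 1$ let $G(n,d/n)$ be the random graph on $n$ vertices in which each pair of vertices is joined independently with probability $d/n$ (read as $1$ if $d>n$). Theorem. Let $d\ge 0$ be a real constant. (i) $G(n,d/n)$ is a.a.s. contained in a graph class of bounded expansion: there is a graph class $\mathcal C$ of bounded expansion (which may depend on $d$ but not on $n$) such that $\Pr[G(n,d/n)\in\mathcal C]\to 1$ as $n\to\infty$. (ii) If $d\ge 16$, then for all integers $n\ge 1$, $r\ge 0$ and $k\ge 0$, the probability that $G(n,d/n)$ has an $r$-shallow topological minor with exactly $k$ vertices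 and at least $8k\,d^{2r+1}$ edges is at most $\max\{n^{-2k},\,2^{-n^{2/3}}\}$. (iii) If $d<16$, then for all integers $n\ge 1$, $r\ge 0$ and $k\ge 0$, the probability that $G(n,d/n)$ has an $r$-shallow topological minor with exactly $k$ vertices and at least $8k\cdot 16^{2r+1}$ edges is at most $\max\{n^{-2k},\,2^{-n^{2/3}}\}$. -/

import Mathlib

open MeasureTheory Filter Topology
open scoped ENNReal

/-- `M` is an `r`-shallow topological minor of `G`: the vertices of `M` are mapped injectively to
vertices of `G` (the nails) and each edge of `M` is modelled by a path of length at most `2 * r + 1`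
in `G` between the corresponding nails. The two orientations of an edge of `M` use the same path,
a path meets the nails only in its two ends, and two paths which model different edges have no
vertex in common other than nails (hence other than a common end). -/
def IsShallowTopologicalMinor {W V : Type*} (r : ℕ) (M : SimpleGraph W) (G : SimpleGraph V) :
    Prop :=
  ∃ (nail : W → V) (path : ∀ u v : W, M.Adj u v → G.Walk (nail u) (nail v)),
    Function.Injective nail ∧
    (∀ (u v : W) (h : M.Adj u v), (path u v h).IsPath ∧ (path u v h).length ≤ 2 * r + 1) ∧
    (∀ (u v : W) (h : M.Adj u v), path v u h.symm = (path u v h).reverse) ∧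
    (∀ (u v : W) (h : M.Adj u v) (w : W), nail w ∈ (path u v h).support → w = u ∨ w = v) ∧
    (∀ (u v u' v' : W) (h : M.Adj u v) (h' : M.Adj u' v'), s(u, v) ≠ s(u', v') →
      ∀ x : V, x ∈ (path u v h).support → x ∈ (path u' v' h').support → x ∈ Set.range nail)

/-- The topological grad of `G` at depth `r`: the largest ratio `|E(H)| / |V(H)|` over all
`r`-shallow topological minors `H` of `G`. As this is invariant under isomorphism, `H` ranges over
the graphs on `Fin k`, `k : ℕ`; the empty graph contributes `0 / 0 = 0`. -/
noncomputable def topologicalGrad {V : Type*} (r : ℕ) (G : SimpleGraph V) : ℝ≥0∞ :=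
  ⨆ (k : ℕ) (H : SimpleGraph (Fin k)) (_ : IsShallowTopologicalMinor r H G),
    (H.edgeSet.ncard : ℝ≥0∞) / (k : ℝ≥0∞)

/-- A graph class: a collection of finite graphs that is closed under isomorphism. -/
structure GraphClass where
  /-- The graph `G` belongs to the class. -/
  Mem : ∀ {V : Type}, SimpleGraph V → Prop
  finite_of_mem : ∀ {V : Type} {G : SimpleGraph V}, Mem G → Finite V
  mem_of_iso : ∀ {V W : Type} {G : SimpleGraph V} {H : SimpleGraph W},
    Nonempty (G ≃g H) → Mem G → Mem H

/-- The topological grad of a graph class at depth `r`: the supremum over its members. -/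
noncomputable def GraphClass.topologicalGrad (C : GraphClass) (r : ℕ) : ℝ≥0∞ :=
  ⨆ (V : Type) (G : SimpleGraph V) (_ : C.Mem G), _root_.topologicalGrad r G

/-- A graph class has bounded expansion if its topological grad at every depth `r` is less than
`f r`, for some real-valued function `f`. -/
def GraphClass.HasBoundedExpansion (C : GraphClass) : Prop :=
  ∃ f : ℕ → ℝ, ∀ r : ℕ, C.topologicalGrad r < ENNReal.ofReal (f r)

/-- The edge probability `d / n`, truncated to the unit interval (which only matters when
`d / n` is not a probability). -/
noncomputable def edgeProbability (d : ℝ) (n : ℕ) : unitInterval :=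
  Set.projIcc (0 : ℝ) 1 zero_le_one (d / n)

/-- The law of the Erdős–Rényi random graph `G(n, d / n)` on the vertex set `Fin n`. -/
noncomputable def erdosRenyi (n : ℕ) (d : ℝ) : Measure (SimpleGraph (Fin n)) :=
  SimpleGraph.binomialRandom (Fin n) (edgeProbability d n)

/-- The graphs on `n` vertices that have some `r`-shallow topological minor with exactly `k`
vertices and at least `m` edges. -/
def hasDenseShallowMinor (n r k : ℕ) (m : ℝ) : Set (SimpleGraph (Fin n)) :=
  {G | ∃ M : SimpleGraph (Fin k), IsShallowTopologicalMinor r M G ∧ m ≤ (M.edgeSet.ncard : ℝ)}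

/-!
Fix `D ≥ 16` with `d ≤ D`, and let `A = D ^ (2 * r + 1)`. If `G(n, d / n)` has an `r`-shallow
topological minor with `k` vertices and at least `m = ⌈8 * k * A⌉` edges, then there are a set of
`k` nails, `m` pairs of nails, and `m` paths of length at most `2 * r + 1` in the random graph which
join these pairs. The paths have pairwise disjoint edge sets, because a common edge of two of them
would join two nails and hence be modelled by both
(`IsShallowTopologicalMinor.exists_disjoint_edge_sets`).

For a fixed choice of pairs the events that disjoint edge sets are present are independent, so that
the expected number of systems of paths is at most the product, over the pairs, of the expected
number of paths (`binomialRandom_real_disjoint_family_le`). A pair is joined by at most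
`n ^ (l - 1)` paths of length `l` in the complete graph, and so the expected number of paths is at
most `∑ l, n ^ (l - 1) * (D / n) ^ l ≤ 2 * A / n` (`sum_pathEdgeSets_le`). Altogether the
probability is at most `n.choose k * (k ^ 2).choose m * (2 * A / n) ^ m`
(`erdosRenyi_real_hasDenseShallowMinor_le`). With `N.choose j ≤ (3 * N / j) ^ j` and `m ≥ 128 * k`
this is at most `(1 / 2 * (k / n) ^ 127) ^ k`, which is below the required maximum: one compares `k`
with `n ^ (2 / 3)`. This gives the two tail bounds, with `D = d` and `D = 16`.

For the first part, take the class of the finite graphs whose topological grad is at most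
`8 * D ^ (2 * r + 1)` at every depth `r`, with `D = max d 16`. A graph on `n` vertices outside the
class has a too dense minor with `2 ≤ k ≤ n` vertices at a depth at most `n`
(`exists_mem_hasDenseShallowMinor`). There are at most `2 * n ^ 2` such pairs of a depth and a `k`,
and each has probability at most `n ^ (-4) + 2 ^ (-n ^ (2 / 3))`, so the total tends to zero.
-/

/-! ### Elementary estimates -/

lemma choose_le_three_mul_div_pow (n k : ℕ) : (n.choose k : ℝ) ≤ (3 * n / k) ^ k := by
  rcases Nat.eq_zero_or_pos k with rfl | hk
  · simp
  have hk' : (0 : ℝ) < k := by exact_mod_cast hk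
  have hfac : (0 : ℝ) < k.factorial := by positivity
  have h1 : (k : ℝ) ^ k / k.factorial ≤ 3 ^ k := by
    calc (k : ℝ) ^ k / k.factorial
        ≤ ∑ i ∈ Finset.range (k + 1), (k : ℝ) ^ i / i.factorial :=
          Finset.single_le_sum (f := fun i : ℕ => (k : ℝ) ^ i / i.factorial)
            (fun i _ => by positivity) (Finset.self_mem_range_succ k)
      _ ≤ Real.exp k := Real.sum_le_exp_of_nonneg hk'.le _
      _ = Real.exp 1 ^ k := by rw [← Real.exp_nat_mul, mul_one]
      _ ≤ 3 ^ k := by gcongr; exact Real.exp_one_lt_three.le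
  calc (n.choose k : ℝ) ≤ (n : ℝ) ^ k / k.factorial := Nat.choose_le_pow_div k n
    _ = (n / k : ℝ) ^ k * ((k : ℝ) ^ k / k.factorial) := by
        rw [div_pow]; field_simp
    _ ≤ (n / k : ℝ) ^ k * 3 ^ k := by gcongr
    _ = (3 * n / k) ^ k := by rw [← mul_pow]; ring

lemma sum_range_pow_succ_le {D : ℝ} (hD : 2 ≤ D) (L : ℕ) :
    ∑ l ∈ Finset.range L, D ^ (l + 1) ≤ 2 * D ^ L := by
  induction L with
  | zero => simp
  | succ L ih =>
    rw [Finset.sum_range_succ]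
    have : 2 * D ^ L ≤ D ^ (L + 1) := by rw [pow_succ']; gcongr
    linarith

/-! ### Counting paths of bounded length -/

section Walks
variable {V : Type*} [Fintype V] [DecidableEq V]

lemma card_finsetWalkLength_succ_le (G : SimpleGraph V) [DecidableRel G.Adj] (l : ℕ) (u v : V) :
    (G.finsetWalkLength (l + 1) u v).card ≤ Fintype.card V ^ l := by
  induction l generalizing u with
  | zero =>
    refine Finset.card_le_one.2 fun p hp q hq => ?_
    rw [SimpleGraph.mem_finsetWalkLength_iff] at hp hq
    cases p with
    | nil => simp at hp
    | cons h p' =>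
      cases q with
      | nil => simp at hq
      | cons h' q' =>
        cases p' with
        | cons _ _ => simp at hp
        | nil =>
          cases q' with
          | nil => rfl
          | cons _ _ => simp at hq
  | succ l ih =>
    rw [SimpleGraph.finsetWalkLength]
    refine Finset.card_biUnion_le.trans ?_
    calc ∑ w : G.neighborSet u, _ ≤ ∑ w : G.neighborSet u, Fintype.card V ^ l :=
          Finset.sum_le_sum fun w _ => by rw [Finset.card_map]; exact ih _
      _ = Fintype.card (G.neighborSet u) * Fintype.card V ^ l := by simp
      _ ≤ Fintype.card V * Fintype.card V ^ l := by
          gcongr; exact Fintype.card_subtype_le _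
      _ = Fintype.card V ^ (l + 1) := (pow_succ' _ _).symm

/-- The edge sets of the paths of length at most `L` from `u` to `v` in the complete graph. -/
def pathEdgeSets (L : ℕ) (u v : V) : Finset (Finset (Sym2 V)) :=
  {p ∈ (⊤ : SimpleGraph V).finsetWalkLengthLT (L + 1) u v | p.IsPath}.image
    fun p => p.edges.toFinset

lemma edges_toFinset_mem_pathEdgeSets {G : SimpleGraph V} {L : ℕ} {u v : V} (p : G.Walk u v)
    (hp : p.IsPath) (hL : p.length ≤ L) : p.edges.toFinset ∈ pathEdgeSets L u v := by
  refine Finset.mem_image.2 ⟨p.mapLe le_top, ?_, by rw [SimpleGraph.Walk.edges_mapLe_eq_edges]⟩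
  simp [SimpleGraph.mem_finsetWalkLengthLT_iff, hp, hL]

/-- If edges are present with probability `c ≤ D / |V|`, the expected number of paths of length at
most `L` between two given vertices is at most `2 * D ^ L / |V|`: there are at most `|V| ^ (l - 1)`
such paths of length `l`. -/
lemma sum_pathEdgeSets_le {u v : V} (huv : u ≠ v) {c D : ℝ} (hc : 0 ≤ c)
    (hcD : c ≤ D / Fintype.card V) (hD : 2 ≤ D) (L : ℕ) :
    ∑ T ∈ pathEdgeSets L u v, c ^ T.card ≤ 2 * D ^ L / Fintype.card V := by
  have hN : (0 : ℝ) < Fintype.card V := by exact_mod_cast Fintype.card_pos_iff.2 ⟨u⟩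
  set N : ℝ := (Fintype.card V : ℝ)
  calc ∑ T ∈ pathEdgeSets L u v, c ^ T.card
      ≤ ∑ p ∈ (⊤ : SimpleGraph V).finsetWalkLengthLT (L + 1) u v with p.IsPath,
          c ^ p.edges.toFinset.card :=
        Finset.sum_image_le_of_nonneg fun T _ => by positivity
    _ = ∑ p ∈ (⊤ : SimpleGraph V).finsetWalkLengthLT (L + 1) u v with p.IsPath, c ^ p.length :=
        Finset.sum_congr rfl fun p hp => by
          rw [List.toFinset_card_of_nodup (Finset.mem_filter.1 hp).2.isTrail.edges_nodup,
            SimpleGraph.Walk.length_edges]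
    _ ≤ ∑ p ∈ (⊤ : SimpleGraph V).finsetWalkLengthLT (L + 1) u v, c ^ p.length :=
        Finset.sum_le_sum_of_subset_of_nonneg (Finset.filter_subset _ _) fun p _ _ => by positivity
    _ = ∑ l ∈ Finset.range (L + 1), ((⊤ : SimpleGraph V).finsetWalkLength l u v).card * c ^ l := by
        refine (Finset.sum_disjiUnion _ _ _).trans (Finset.sum_congr rfl fun l _ => ?_)
        rw [Finset.sum_congr rfl fun p hp => by
          rw [SimpleGraph.mem_finsetWalkLength_iff.1 hp], Finset.sum_const, nsmul_eq_mul]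
    _ = ∑ l ∈ Finset.range L,
          ((⊤ : SimpleGraph V).finsetWalkLength (l + 1) u v).card * c ^ (l + 1) := by
        rw [Finset.sum_range_succ']
        simp [SimpleGraph.finsetWalkLength, huv]
    _ ≤ ∑ l ∈ Finset.range L, N ^ l * (D / N) ^ (l + 1) := by
        gcongr with l
        exact (Nat.cast_le.2 (card_finsetWalkLength_succ_le _ l u v)).trans_eq (Nat.cast_pow _ _)
    _ = (∑ l ∈ Finset.range L, D ^ (l + 1)) / N := by
        rw [Finset.sum_div]
        refine Finset.sum_congr rfl fun l _ => ?_
        rw [div_pow, pow_succ N]; field_simp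
    _ ≤ 2 * D ^ L / N := by gcongr; exact sum_range_pow_succ_le hD L

end Walks

/-! ### Union bounds in the binomial random graph -/

section Measure
variable {V : Type*} [Fintype V] [DecidableEq V]

/-- This is an inequality only because a loop in `T` makes the event empty. -/
lemma binomialRandom_real_subset_edgeSet_le (p : unitInterval) (T : Finset (Sym2 V)) :
    (SimpleGraph.binomialRandom V p).real {G | (T : Set (Sym2 V)) ⊆ G.edgeSet} ≤
      (p : ℝ) ^ T.card := by
  have h : SimpleGraph.binomialRandom V p {G | (T : Set (Sym2 V)) ⊆ G.edgeSet} ≤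
      (unitInterval.toNNReal p : ℝ≥0∞) ^ T.card := by
    rw [SimpleGraph.binomialRandom_apply]
    refine (measure_mono (t := Set.pi T fun _ => {True}) ?_).trans ?_
    · rintro _ ⟨G, hG, rfl⟩ e he
      simpa using hG he
    · rw [Measure.infinitePi_pi _ (fun _ _ => measurableSet_singleton _)]
      refine Finset.prod_le_pow_card _ _ _ fun e _ => ?_
      by_cases he : e.IsDiag <;> simp [he]
  refine (ENNReal.toReal_mono (by finiteness) h).trans_eq ?_
  simp

/-- Union bound over systems of pairwise disjoint edge sets: the expected number of such systems
that are contained in the random graph factorizes over the index set. -/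
lemma binomialRandom_real_disjoint_family_le {ι : Type*} [Fintype ι] (p : unitInterval)
    (P : ι → Finset (Finset (Sym2 V))) :
    (SimpleGraph.binomialRandom V p).real
      {G | ∃ T : ι → Finset (Sym2 V), (∀ i, T i ∈ P i) ∧ Pairwise (fun i j => Disjoint (T i) (T j)) ∧
        ∀ i, (T i : Set (Sym2 V)) ⊆ G.edgeSet} ≤
      ∏ i, ∑ T ∈ P i, (p : ℝ) ^ T.card := by
  classical
  set μ := SimpleGraph.binomialRandom V p
  rw [Finset.prod_univ_sum]
  let F := {T ∈ Fintype.piFinset P | Pairwise (fun i j => Disjoint (T i) (T j))}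
  calc _ ≤ μ.real (⋃ T ∈ F, {G | (Finset.univ.biUnion T : Set (Sym2 V)) ⊆ G.edgeSet}) := by
        refine measureReal_mono ?_ (measure_ne_top (SimpleGraph.binomialRandom V p) _)
        rintro G ⟨T, hTP, hT, hG⟩
        refine Set.mem_biUnion (x := T) ?_ ?_
        · simpa [F, hTP] using hT
        · simpa using hG
    _ ≤ ∑ T ∈ F, μ.real {G | (Finset.univ.biUnion T : Set (Sym2 V)) ⊆ G.edgeSet} :=
        measureReal_biUnion_finset_le _ _
    _ ≤ ∑ T ∈ F, ∏ i, (p : ℝ) ^ (T i).card := by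
        refine Finset.sum_le_sum fun T hT => ?_
        have hT' := (Finset.mem_filter.1 hT).2
        have := binomialRandom_real_subset_edgeSet_le p (Finset.univ.biUnion T)
        rwa [Finset.card_biUnion fun i _ j _ hij => hT' hij, ← Finset.prod_pow_eq_pow_sum] at this
    _ ≤ _ := Finset.sum_le_sum_of_subset_of_nonneg (Finset.filter_subset _ _) fun T _ _ =>
        Finset.prod_nonneg fun i _ => pow_nonneg p.2.1 _

end Measure

/-! ### Dense shallow topological minors are unlikely -/

/-- The certificate used for the union bound: a set `S` of nails, a set `E` of `m` ordered pairs of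
nails, one for each of `m` edges of the minor (the orientation comes from `Quot.out`), and pairwise
disjoint edge sets of paths which model them. -/
lemma IsShallowTopologicalMinor.exists_disjoint_edge_sets {V W : Type*} [Fintype V] [DecidableEq V]
    [Fintype W] {r : ℕ} {M : SimpleGraph W} {G : SimpleGraph V}
    (h : IsShallowTopologicalMinor r M G) {m : ℕ} (hm : m ≤ M.edgeSet.ncard) :
    ∃ S ∈ Finset.powersetCard (Fintype.card W) (Finset.univ : Finset V),
      ∃ E ∈ Finset.powersetCard m S.offDiag, ∃ T : E → Finset (Sym2 V),
        (∀ e, T e ∈ pathEdgeSets (2 * r + 1) e.1.1 e.1.2) ∧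
        Pairwise (fun e e' => Disjoint (T e) (T e')) ∧
        ∀ e, (T e : Set (Sym2 V)) ⊆ G.edgeSet := by
  classical
  obtain ⟨nail, path, hinj, hpath, -, hnail, hdisj⟩ := h
  rw [Set.ncard_eq_toFinset_card'] at hm
  obtain ⟨A, hA, rfl⟩ := Finset.exists_subset_card_eq hm
  have hout : ∀ a : Sym2 W, s(a.out.1, a.out.2) = a := fun a => Quot.out_eq a
  have hadj : ∀ a ∈ A, M.Adj a.out.1 a.out.2 := fun a ha => by
    rw [← SimpleGraph.mem_edgeSet, hout]; simpa using hA ha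
  let g : Sym2 W → V × V := fun a => (nail a.out.1, nail a.out.2)
  have hg : Function.Injective g := fun a b hab => by
    have h1 := hinj (Prod.ext_iff.1 hab).1
    have h2 := hinj (Prod.ext_iff.1 hab).2
    rw [← hout a, ← hout b, h1, h2]
  have key : ∀ e : A.image g, ∃ (T : Finset (Sym2 V)), ∃ a, ∃ ha : a ∈ A, g a = e ∧
      T = (path _ _ (hadj a ha)).edges.toFinset := fun e => by
    obtain ⟨a, ha, hae⟩ := Finset.mem_image.1 e.2
    exact ⟨_, a, ha, hae, rfl⟩
  choose T a ha hae hT using key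
  refine ⟨Finset.univ.image nail, ?_, A.image g, ?_, T, fun e => ?_, fun e e' hee => ?_,
    fun e => ?_⟩
  · simp [Finset.mem_powersetCard, Finset.card_image_of_injective _ hinj]
  · refine Finset.mem_powersetCard.2 ⟨?_, Finset.card_image_of_injective _ hg⟩
    intro x hx
    obtain ⟨b, hb, rfl⟩ := Finset.mem_image.1 hx
    simpa [g] using fun hbb => (hadj b hb).ne (hinj hbb)
  · rw [hT, ← hae]
    exact edges_toFinset_mem_pathEdgeSets _ (hpath _ _ _).1 (hpath _ _ _).2
  · have hne : a e ≠ a e' := fun hh => hee (Subtype.ext (by rw [← hae, ← hae, hh]))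
    show Disjoint (T e) (T e')
    rw [hT e, hT e', Finset.disjoint_left]
    intro x hx hx'
    rw [List.mem_toFinset] at hx hx'
    -- Both ends of a common edge would be nails, and these determine the edge of the minor.
    have hends : ∀ y ∈ x, ∃ w, nail w = y ∧ w ∈ a e ∧ w ∈ a e' := fun y hy => by
      have h1 := SimpleGraph.Walk.mem_support_of_mem_edges hx hy
      have h2 := SimpleGraph.Walk.mem_support_of_mem_edges hx' hy
      obtain ⟨w, rfl⟩ := hdisj _ _ _ _ (hadj _ (ha e)) (hadj _ (ha e')) (by rwa [hout, hout]) y h1 h2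
      refine ⟨w, rfl, ?_, ?_⟩
      · rw [← hout (a e), Sym2.mem_iff]; exact hnail _ _ _ _ h1
      · rw [← hout (a e'), Sym2.mem_iff]; exact hnail _ _ _ _ h2
    have hxG := SimpleGraph.Walk.edges_subset_edgeSet _ hx
    induction x with
    | _ y z =>
      obtain ⟨w, rfl, hw, hw'⟩ := hends y (Sym2.mem_mk_left _ _)
      obtain ⟨w₂, rfl, hw₂, hw₂'⟩ := hends z (Sym2.mem_mk_right _ _)
      have hww : w ≠ w₂ := by rintro rfl; simp at hxG
      exact hne (((Sym2.mem_and_mem_iff hww).1 ⟨hw, hw₂⟩).trans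
        ((Sym2.mem_and_mem_iff hww).1 ⟨hw', hw₂'⟩).symm)
  · rw [hT]
    intro x hx
    exact SimpleGraph.Walk.edges_subset_edgeSet _ (List.mem_toFinset.1 hx)

lemma edgeProbability_le {d : ℝ} (hd : 0 ≤ d) (n : ℕ) : (edgeProbability d n : ℝ) ≤ d / n := by
  rw [edgeProbability, Set.coe_projIcc]
  exact max_le (by positivity) (min_le_right _ _)

/-- The union bound over all certificates. As `E` consists of ordered pairs, the number of choices
for it is bounded by means of `k ^ 2` in place of `k.choose 2`; the factor two is harmless. -/
lemma erdosRenyi_real_hasDenseShallowMinor_le {d D : ℝ} (hd : 0 ≤ d) (hdD : d ≤ D) (hD : 2 ≤ D)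
    (n r k : ℕ) (x : ℝ) :
    (erdosRenyi n d).real (hasDenseShallowMinor n r k x) ≤
      n.choose k * ((k ^ 2).choose ⌈x⌉₊ * (2 * D ^ (2 * r + 1) / n) ^ ⌈x⌉₊) := by
  set w : ℝ := 2 * D ^ (2 * r + 1) / n
  have hw : 0 ≤ w := by positivity
  let B (E : Finset (Fin n × Fin n)) : Set (SimpleGraph (Fin n)) :=
    {G | ∃ T : E → Finset (Sym2 (Fin n)),
        (∀ e, T e ∈ pathEdgeSets (2 * r + 1) e.1.1 e.1.2) ∧
        Pairwise (fun e e' => Disjoint (T e) (T e')) ∧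
        ∀ e, (T e : Set (Sym2 (Fin n))) ⊆ G.edgeSet}
  have hp : (edgeProbability d n : ℝ) ≤ D / Fintype.card (Fin n) := by
    rw [Fintype.card_fin]; exact (edgeProbability_le hd n).trans (by gcongr)
  have hB : ∀ S : Finset (Fin n), ∀ E ∈ Finset.powersetCard ⌈x⌉₊ S.offDiag,
      (erdosRenyi n d).real (B E) ≤ w ^ ⌈x⌉₊ := fun S E hE => by
    obtain ⟨hES, hcard⟩ := Finset.mem_powersetCard.1 hE
    refine (binomialRandom_real_disjoint_family_le _ _).trans ?_
    refine (Finset.prod_le_prod (fun _ _ => Finset.sum_nonneg fun T _ => by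
      have := (edgeProbability d n).2.1; positivity) fun e _ =>
      sum_pathEdgeSets_le (Finset.mem_offDiag.1 (hES e.2)).2.2 (edgeProbability d n).2.1 hp hD
        (2 * r + 1)).trans_eq ?_
    rw [Finset.prod_const, Finset.card_univ, Fintype.card_coe, hcard, Fintype.card_fin]
  have : IsProbabilityMeasure (erdosRenyi n d) :=
    inferInstanceAs (IsProbabilityMeasure (SimpleGraph.binomialRandom _ _))
  calc (erdosRenyi n d).real (hasDenseShallowMinor n r k x)
      ≤ (erdosRenyi n d).real (⋃ S ∈ Finset.powersetCard k (Finset.univ : Finset (Fin n)),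
          ⋃ E ∈ Finset.powersetCard ⌈x⌉₊ S.offDiag, B E) := by
        refine measureReal_mono ?_ (measure_ne_top _ _)
        rintro G ⟨M, hM, hx⟩
        obtain ⟨S, hS, E, hE, hT⟩ := hM.exists_disjoint_edge_sets (Nat.ceil_le.2 hx)
        rw [Fintype.card_fin] at hS
        exact Set.mem_biUnion hS (Set.mem_biUnion hE hT)
    _ ≤ ∑ S ∈ Finset.powersetCard k (Finset.univ : Finset (Fin n)),
          (k ^ 2).choose ⌈x⌉₊ * w ^ ⌈x⌉₊ := by
        refine (measureReal_biUnion_finset_le _ _).trans (Finset.sum_le_sum fun S hS => ?_)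
        refine (measureReal_biUnion_finset_le _ _).trans ?_
        refine (Finset.sum_le_sum (hB S)).trans ?_
        rw [Finset.sum_const, Finset.card_powersetCard, nsmul_eq_mul, Finset.offDiag_card,
          (Finset.mem_powersetCard.1 hS).2]
        gcongr
        rw [sq]; exact Nat.sub_le _ _
    _ = _ := by
        rw [Finset.sum_const, Finset.card_powersetCard, nsmul_eq_mul, Finset.card_univ,
          Fintype.card_fin]

/-- The union bound as a `k`-th power: since `m ≥ 8 * k * A`, each of the `m` modelled edges
contributes a factor at most `3 / 4 * (k / n)`, and `m ≥ 128 * k` such factors outweigh the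
`(3 * n / k) ^ k` choices of the nails. -/
lemma choose_mul_choose_mul_pow_le {n k m : ℕ} {A : ℝ} (hn : 1 ≤ n) (hk : 1 ≤ k) (hA : 16 ≤ A)
    (hm : 8 * k * A ≤ m) :
    (n.choose k : ℝ) * ((k ^ 2).choose m * (2 * A / n) ^ m) ≤
      (1 / 2 * (k / n : ℝ) ^ 127) ^ k := by
  have hn' : (0 : ℝ) < n := by exact_mod_cast hn
  have hk' : (0 : ℝ) < k := by exact_mod_cast hk
  rcases lt_or_ge n k with hnk | hkn
  · rw [Nat.choose_eq_zero_of_lt hnk]; simp; positivity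
  have hkn' : (k : ℝ) / n ≤ 1 := (div_le_one hn').2 (by exact_mod_cast hkn)
  have hm' : (0 : ℝ) < m := lt_of_lt_of_le (by positivity) hm
  have hmk : 128 * k ≤ m := by
    have : (128 * k : ℝ) ≤ m := by nlinarith
    exact_mod_cast this
  calc (n.choose k : ℝ) * ((k ^ 2).choose m * (2 * A / n) ^ m)
      ≤ (3 * n / k) ^ k * ((3 * (k ^ 2 : ℕ) / m) ^ m * (2 * A / n) ^ m) := by
        gcongr <;> exact choose_le_three_mul_div_pow _ _
    _ = (3 * n / k) ^ k * (3 * k ^ 2 * (2 * A) / (m * n)) ^ m := by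
        rw [← mul_pow]; push_cast; congr 2; field_simp
    _ ≤ (3 * n / k) ^ k * (3 / 4 * (k / n : ℝ)) ^ m := by
        gcongr
        rw [div_le_iff₀ (by positivity)]
        have : 3 / 4 * (k / n : ℝ) * (m * n) = 3 / 4 * k * m := by field_simp
        rw [this]; nlinarith
    _ ≤ (3 * n / k) ^ k * (3 / 4 * (k / n : ℝ)) ^ (128 * k) := by
        gcongr ?_ * ?_
        exact pow_le_pow_of_le_one (by positivity) (by linarith) hmk
    _ = (9 / 4 * (3 / 4) ^ 127 * (k / n : ℝ) ^ 127) ^ k := by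
        rw [pow_mul, ← mul_pow, mul_pow (3 / 4 : ℝ) _ 128, pow_succ (k / n : ℝ) 127]
        congr 1
        field_simp
        norm_num
    _ ≤ (1 / 2 * (k / n : ℝ) ^ 127) ^ k := by
        gcongr; norm_num

/-- If `k ≥ n ^ (2 / 3)`, the factors `1 / 2` suffice; otherwise `k / n ≤ n ^ (-1 / 3)`, and a sixth
power of it suffices. -/
lemma half_mul_pow_le_max {n k : ℕ} (hn : 1 ≤ n) (hkn : k ≤ n) :
    (1 / 2 * (k / n : ℝ) ^ 127) ^ k ≤
      max ((n : ℝ) ^ (-(2 * (k : ℝ)))) ((2 : ℝ) ^ (-((n : ℝ) ^ (2 / 3 : ℝ)))) := by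
  have hn' : (0 : ℝ) < n := by exact_mod_cast hn
  have ht : (k : ℝ) / n ≤ 1 := (div_le_one hn').2 (by exact_mod_cast hkn)
  have ht0 : (0 : ℝ) ≤ (k : ℝ) / n := by positivity
  rcases le_total ((n : ℝ) ^ (2 / 3 : ℝ)) k with h | h
  · refine le_max_of_le_right ?_
    calc (1 / 2 * (k / n : ℝ) ^ 127) ^ k ≤ (1 / 2 * 1) ^ k := by
          gcongr; exact pow_le_one₀ ht0 ht
      _ = (2 : ℝ) ^ (-(k : ℝ)) := by
          rw [Real.rpow_neg (by norm_num), Real.rpow_natCast]; simp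
      _ ≤ _ := Real.rpow_le_rpow_of_exponent_le (by norm_num) (neg_le_neg h)
  · refine le_max_of_le_left ?_
    have h3 : (k / n : ℝ) ≤ (n : ℝ) ^ (-(1 / 3) : ℝ) := by
      rw [div_le_iff₀ hn', ← Real.rpow_add_one hn'.ne']
      norm_num; exact h
    have hle : (1 / 2 * (k / n : ℝ) ^ 127) ≤ (n : ℝ) ^ (-2 : ℝ) :=
      calc (1 / 2 * (k / n : ℝ) ^ 127) ≤ 1 * (k / n : ℝ) ^ 6 :=
            mul_le_mul (by norm_num) (pow_le_pow_of_le_one ht0 ht (by norm_num))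
              (by positivity) (by norm_num)
        _ ≤ 1 * ((n : ℝ) ^ (-(1 / 3) : ℝ)) ^ 6 := by gcongr
        _ = (n : ℝ) ^ (-2 : ℝ) := by
            rw [one_mul, ← Real.rpow_natCast, ← Real.rpow_mul hn'.le]; norm_num
    calc _ ≤ ((n : ℝ) ^ (-2 : ℝ)) ^ k := by gcongr
      _ = _ := by rw [← Real.rpow_natCast, ← Real.rpow_mul hn'.le]; ring_nf

lemma erdosRenyi_real_hasDenseShallowMinor_le_max {d D : ℝ} (hd : 0 ≤ d) (hdD : d ≤ D)
    (hD : 16 ≤ D) (n r k : ℕ) (hn : 1 ≤ n) :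
    (erdosRenyi n d).real (hasDenseShallowMinor n r k (8 * (k : ℝ) * D ^ (2 * r + 1))) ≤
      max ((n : ℝ) ^ (-(2 * (k : ℝ)))) ((2 : ℝ) ^ (-((n : ℝ) ^ (2 / 3 : ℝ)))) := by
  have : IsProbabilityMeasure (erdosRenyi n d) :=
    inferInstanceAs (IsProbabilityMeasure (SimpleGraph.binomialRandom _ _))
  rcases Nat.eq_zero_or_pos k with rfl | hk
  -- For `k = 0` the bound `n ^ (-2 * k)` is `1`.
  · exact le_max_of_le_left (by simp)
  have hb := erdosRenyi_real_hasDenseShallowMinor_le hd hdD (by linarith) n r k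
    (8 * (k : ℝ) * D ^ (2 * r + 1))
  rcases lt_or_ge n k with hnk | hkn
  · rw [Nat.choose_eq_zero_of_lt hnk, Nat.cast_zero, zero_mul] at hb
    exact hb.trans (le_max_of_le_left (by positivity))
  refine hb.trans ((choose_mul_choose_mul_pow_le hn hk ?_ (Nat.le_ceil _)).trans
    (half_mul_pow_le_max hn hkn))
  exact hD.trans (le_self_pow₀ (by linarith) (by omega))

/-! ### A graph class of bounded expansion -/

lemma IsShallowTopologicalMinor.map_iso {V V' W : Type*} {r : ℕ} {M : SimpleGraph W}
    {G : SimpleGraph V} {H : SimpleGraph V'} (h : IsShallowTopologicalMinor r M G) (φ : G ≃g H) :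
    IsShallowTopologicalMinor r M H := by
  obtain ⟨nail, path, hinj, hpath, hrev, hnail, hdisj⟩ := h
  refine ⟨φ ∘ nail, fun u v h => (path u v h).map φ.toHom, φ.injective.comp hinj,
    fun u v h => ⟨?_, ?_⟩, fun u v h => ?_, fun u v h w hw => ?_,
    fun u v u' v' h h' hne x hx hx' => ?_⟩
  · exact SimpleGraph.Walk.IsPath.map φ.injective (hpath u v h).1
  · rw [SimpleGraph.Walk.length_map]; exact (hpath u v h).2
  · show (path v u h.symm).map φ.toHom = ((path u v h).map φ.toHom).reverse
    rw [hrev u v h, SimpleGraph.Walk.reverse_map]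
  · rw [SimpleGraph.Walk.support_map, List.mem_map] at hw
    obtain ⟨y, hy, hyw⟩ := hw
    exact hnail u v h w (φ.injective hyw ▸ hy)
  · rw [SimpleGraph.Walk.support_map, List.mem_map] at hx hx'
    obtain ⟨y, hy, rfl⟩ := hx
    obtain ⟨z, hz, hzy⟩ := hx'
    obtain ⟨w, rfl⟩ := hdisj u v u' v' h h' hne y hy (φ.injective hzy ▸ hz)
    exact ⟨w, rfl⟩

/-- Paths have fewer edges than the graph has vertices, so that the depth can be capped. -/
lemma IsShallowTopologicalMinor.depth_card {V W : Type*} [Fintype V] {r : ℕ} {M : SimpleGraph W}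
    {G : SimpleGraph V} (h : IsShallowTopologicalMinor r M G) :
    IsShallowTopologicalMinor (Fintype.card V) M G := by
  obtain ⟨nail, path, hinj, hpath, hrest⟩ := h
  refine ⟨nail, path, hinj, fun u v h => ⟨(hpath u v h).1, ?_⟩, hrest⟩
  have := (hpath u v h).1.length_lt
  omega

lemma topologicalGrad_le_iff {V : Type*} {r : ℕ} {G : SimpleGraph V} {c : ℝ≥0∞} :
    topologicalGrad r G ≤ c ↔ ∀ (k : ℕ) (H : SimpleGraph (Fin k)),
      IsShallowTopologicalMinor r H G → (H.edgeSet.ncard : ℝ≥0∞) / k ≤ c := by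
  simp [topologicalGrad]

/-- The class of the finite graphs whose topological grad is at most `f r` at every depth `r`. -/
def gradBoundedClass (f : ℕ → ℝ) : GraphClass where
  Mem {V} G := Finite V ∧ ∀ r, topologicalGrad r G ≤ ENNReal.ofReal (f r)
  finite_of_mem h := h.1
  mem_of_iso := by
    rintro V W G H ⟨φ⟩ ⟨hV, hG⟩
    refine ⟨Finite.of_equiv V φ.toEquiv, fun r => topologicalGrad_le_iff.2 fun k M hM => ?_⟩
    exact topologicalGrad_le_iff.1 (hG r) k M (hM.map_iso φ.symm)

lemma gradBoundedClass_hasBoundedExpansion {f : ℕ → ℝ} (hf : ∀ r, 0 ≤ f r) :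
    (gradBoundedClass f).HasBoundedExpansion := by
  refine ⟨fun r => f r + 1, fun r => lt_of_le_of_lt (b := ENNReal.ofReal (f r)) ?_ ?_⟩
  · exact iSup_le fun V => iSup_le fun G => iSup_le fun hG => hG.2 r
  · exact (ENNReal.ofReal_lt_ofReal_iff (by linarith [hf r])).2 (by linarith)

/-- A graph outside the class has a too dense shallow topological minor; this minor has at least
two vertices, and its depth may be taken to be at most `n`. -/
lemma exists_mem_hasDenseShallowMinor {D : ℝ} (hD : 1 ≤ D) {n : ℕ} {G : SimpleGraph (Fin n)}
    (hG : ¬ (gradBoundedClass fun r => 8 * D ^ (2 * r + 1)).Mem G) :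
    ∃ r ∈ Finset.range (n + 1), ∃ k ∈ Finset.Icc 2 n,
      G ∈ hasDenseShallowMinor n r k (8 * (k : ℝ) * D ^ (2 * r + 1)) := by
  simp only [gradBoundedClass, not_and, not_forall, topologicalGrad_le_iff, not_le] at hG
  obtain ⟨r, k, M, hM, hlt⟩ := hG inferInstance
  have hne : M.edgeSet.ncard ≠ 0 := fun h0 => by simp [h0] at hlt
  have hk2 : 2 ≤ k := by
    by_contra! hk
    obtain ⟨e, he⟩ := Set.nonempty_of_ncard_ne_zero hne
    have : Subsingleton (Fin k) := Fin.subsingleton_iff_le_one.2 (by omega)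
    induction e with
    | _ u v => exact SimpleGraph.Adj.ne he (Subsingleton.elim u v)
  have hkn : k ≤ n := by
    obtain ⟨nail, -, hinj, -⟩ := hM
    simpa using Fintype.card_le_of_injective nail hinj
  have hk0 : (0 : ℝ) < k := by exact_mod_cast (by omega : 0 < k)
  have hdense : 8 * (k : ℝ) * D ^ (2 * r + 1) ≤ M.edgeSet.ncard := by
    rw [← ENNReal.ofReal_natCast k, ← ENNReal.ofReal_natCast M.edgeSet.ncard,
      ← ENNReal.ofReal_div_of_pos hk0] at hlt
    have := (ENNReal.ofReal_lt_ofReal_iff_of_nonneg (by positivity)).1 hlt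
    rw [lt_div_iff₀ hk0] at this
    linarith
  rcases le_total r n with hr | hr
  · exact ⟨r, Finset.mem_range_succ_iff.2 hr, k, Finset.mem_Icc.2 ⟨hk2, hkn⟩, M, hM, hdense⟩
  · refine ⟨n, Finset.self_mem_range_succ n, k, Finset.mem_Icc.2 ⟨hk2, hkn⟩, M, ?_, ?_⟩
    · simpa using hM.depth_card
    · refine le_trans ?_ hdense
      gcongr

lemma tendsto_sq_mul_two_rpow_neg :
    Tendsto (fun n : ℕ => (n : ℝ) ^ 2 * (2 : ℝ) ^ (-((n : ℝ) ^ (2 / 3 : ℝ)))) atTop (𝓝 0) := by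
  have h := (tendsto_rpow_mul_exp_neg_mul_atTop_nhds_zero 3 (Real.log 2)
    (Real.log_pos one_lt_two)).comp ((tendsto_rpow_atTop (y := (2 / 3 : ℝ)) (by norm_num)).comp
      tendsto_natCast_atTop_atTop)
  refine h.congr fun n => ?_
  simp only [Function.comp_apply]
  rw [← Real.rpow_mul n.cast_nonneg, Real.rpow_def_of_pos two_pos]
  norm_num

lemma tendsto_erdosRenyi_gradBoundedClass {d D : ℝ} (hd : 0 ≤ d) (hdD : d ≤ D) (hD : 16 ≤ D) :
    Tendsto (fun n : ℕ => (erdosRenyi n d).real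
      {G : SimpleGraph (Fin n) | (gradBoundedClass fun r => 8 * D ^ (2 * r + 1)).Mem G})
      atTop (𝓝 1) := by
  have hprob : ∀ n, IsProbabilityMeasure (erdosRenyi n d) := fun n =>
    inferInstanceAs (IsProbabilityMeasure (SimpleGraph.binomialRandom _ _))
  let b (n : ℕ) : ℝ :=
    2 * ((1 / (n : ℝ)) ^ 2 + (n : ℝ) ^ 2 * (2 : ℝ) ^ (-((n : ℝ) ^ (2 / 3 : ℝ))))
  have hb : Tendsto (fun n => 1 - b n) atTop (𝓝 1) := by
    have := ((tendsto_one_div_atTop_nhds_zero_nat (𝕜 := ℝ)).pow 2).add tendsto_sq_mul_two_rpow_neg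
    simpa [b] using (this.const_mul 2).const_sub 1
  refine tendsto_of_tendsto_of_tendsto_of_le_of_le' hb tendsto_const_nhds ?_
    (Eventually.of_forall fun n => measureReal_le_one)
  filter_upwards [eventually_ge_atTop 1] with n hn
  set A := {G : SimpleGraph (Fin n) | (gradBoundedClass fun r => 8 * D ^ (2 * r + 1)).Mem G}
  have hn1 : (1 : ℝ) ≤ n := by exact_mod_cast hn
  have hcompl : (erdosRenyi n d).real Aᶜ ≤ b n := by
    set q : ℝ := (n : ℝ) ^ (-4 : ℝ) + (2 : ℝ) ^ (-((n : ℝ) ^ (2 / 3 : ℝ)))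
    have hq : ∀ r, ∀ k ∈ Finset.Icc 2 n, (erdosRenyi n d).real
        (hasDenseShallowMinor n r k (8 * (k : ℝ) * D ^ (2 * r + 1))) ≤ q := fun r k hk => by
      refine (erdosRenyi_real_hasDenseShallowMinor_le_max hd hdD hD n r k hn).trans
        (max_le ?_ (le_add_of_nonneg_left (by positivity)))
      refine le_add_of_le_of_nonneg (Real.rpow_le_rpow_of_exponent_le hn1 ?_) (by positivity)
      have : (2 : ℝ) ≤ k := by exact_mod_cast (Finset.mem_Icc.1 hk).1
      linarith
    calc (erdosRenyi n d).real Aᶜ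
        ≤ (erdosRenyi n d).real (⋃ r ∈ Finset.range (n + 1), ⋃ k ∈ Finset.Icc 2 n,
            hasDenseShallowMinor n r k (8 * (k : ℝ) * D ^ (2 * r + 1))) := by
          refine measureReal_mono (fun G hG => ?_) (measure_ne_top _ _)
          obtain ⟨r, hr, k, hk, h⟩ := exists_mem_hasDenseShallowMinor (by linarith) hG
          exact Set.mem_biUnion hr (Set.mem_biUnion hk h)
      _ ≤ ∑ r ∈ Finset.range (n + 1), ∑ k ∈ Finset.Icc 2 n, q :=
          (measureReal_biUnion_finset_le _ _).trans (Finset.sum_le_sum fun r _ =>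
            (measureReal_biUnion_finset_le _ _).trans (Finset.sum_le_sum (hq r)))
      _ = (n + 1) * ((n - 1) * q) := by
          simp [Nat.cast_sub hn]
      _ ≤ 2 * (n ^ 2 * q) := by
          have : 0 ≤ q := by positivity
          nlinarith [mul_nonneg (sq_nonneg (n : ℝ)) this]
      _ = b n := by
          have : (n : ℝ) ^ (-4 : ℝ) = 1 / (n : ℝ) ^ 4 := by
            rw [Real.rpow_neg (by positivity), one_div]; norm_cast
          simp only [b, q, this]
          field_simp
  have hsum : 1 ≤ (erdosRenyi n d).real A + (erdosRenyi n d).real Aᶜ := by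
    simpa using measureReal_union_le (μ := erdosRenyi n d) A Aᶜ
  linarith

theorem theorem1 (d : ℝ) (hd : 0 ≤ d) :
    (∃ C : GraphClass, C.HasBoundedExpansion ∧
      Tendsto (fun n : ℕ => (erdosRenyi n d).real {G : SimpleGraph (Fin n) | C.Mem G})
        atTop (𝓝 1)) ∧
    (16 ≤ d → ∀ n r k : ℕ, 1 ≤ n →
      (erdosRenyi n d).real (hasDenseShallowMinor n r k (8 * (k : ℝ) * d ^ (2 * r + 1))) ≤
        max ((n : ℝ) ^ (-(2 * (k : ℝ)))) ((2 : ℝ) ^ (-((n : ℝ) ^ (2 / 3 : ℝ))))) ∧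
    (d < 16 → ∀ n r k : ℕ, 1 ≤ n →
      (erdosRenyi n d).real (hasDenseShallowMinor n r k (8 * (k : ℝ) * 16 ^ (2 * r + 1))) ≤
        max ((n : ℝ) ^ (-(2 * (k : ℝ)))) ((2 : ℝ) ^ (-((n : ℝ) ^ (2 / 3 : ℝ))))) := by
  refine ⟨⟨gradBoundedClass fun r => 8 * max d 16 ^ (2 * r + 1), ?_, ?_⟩,
    fun h n r k hn => erdosRenyi_real_hasDenseShallowMinor_le_max hd le_rfl h n r k hn,
    fun h n r k hn => erdosRenyi_real_hasDenseShallowMinor_le_max hd h.le le_rfl n r k hn⟩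
  · exact gradBoundedClass_hasBoundedExpansion fun r => by positivity
  · exact tendsto_erdosRenyi_gradBoundedClass hd (le_max_left _ _) (le_max_right _ _)
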